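/- **Setting.** Let $\mathcal G$ be a causal diagram on a finite vertex set $\mathbf V$ (an acyclic set of directed edges together with bidirected edges) and let $Y\in\mathbf V$ be the reward variable. $\mathcal G_{\overline{\mathbf X}}$ (resp. $\mathcal G_{\underline{\mathbf X}}$) is $\mathcal G$ without the (directed and bidirected) edges into $\mathbf X$ (resp. without the directed edges out of $\mathbf X$); $\mathcal G[\mathbf A]$ is the induced subgraph; $\mathrm{An}$, $\mathrm{De}$ are inclusive ancestors and descendants, $\mathrm{Pa}$ parents, and $\mathrm{CC}(\mathbf T)$ the set of vertices joined to $\mathbf T$ by bidirected paths, including $\mathbf T$. With $\mathcal H=\mathcal G[\mathrm{An}(Y)_{\mathcal G}]$, $\mathsf{MUCT}(\mathcal G,Y)$ is the smallest set $\mathbf T$ of vertices of $\mathcal H$ with $Y\in\mathbf T$, $\mathrm{De}(\mathbf T)_{\mathcal H}=\mathbf T$, $\mathrm{CC}(\mathbf T)_{\mathcal H}=\mathbf T$, and $\mathsf{IB}(\mathcal G,Y)=\mathrm{Pa}(\mathbf T)_{\mathcal G}\setminus\mathbf T$ for this $\mathbf T$. A model conforming to $\mathcal G$ is a structural causal model with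 finite domains, real-valued reward and independent exogenous variables (finitely many, with arbitrary distributions) in which the function of a variable takes its parents in $\mathcal G$ and some exogenous variables as arguments, two variables sharing an exogenous argument only if they are joined by a bidirected edge. Write $\mathbb E_{P_{\mathbf x}}Y$ for the expected reward under $do(\mathbf X=\mathbf x)$. For sets $\mathbf X,\mathbf W\subseteq\mathbf V\setminus\{Y\}$: * $\mathbf X$ and $\mathbf W$ are *equivalent* if $\mathbb E_{P_{\mathbf v[\mathbf X]}}Y=\mathbb E_{P_{\mathbf v[\mathbf W]}}Y$ for every model conforming to $\mathcal G$ and every joint value $\mathbf v$ of $\mathbf V$, where $\mathbf v[\mathbf X]$ is the restriction of $\mathbf v$ to $\mathbf X$; * $\mathbf X$ is an *MIS* if no proper subset of it is equivalent to it; * $\mathbf X$ is a *POMIS* if it is an MIS and in some model conforming to $\mathcal G$, $\max_{\mathbf x}\mathbb E_{P_{\mathbf x}}Y>\max_{\mathbf w}\mathbb E_{P_{\mathbf w}}Y$ for every other MIS $\mathbf W$; * $\mathbf X$ is a *POIS* if in some model conforming to $\mathcal G$, $\max_{\mathbf x}\mathbb E_{P_{\mathbf x}}Y>\max_{\mathbf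 w}\mathbb E_{P_{\mathbf w}}Y$ for every $\mathbf W$ not equivalent to $\mathbf X$. **Causal bounds.** Let a target environment $\pi^*$ and source environments $\pi^1,\dots,\pi^n$ be given by models conforming to $\mathcal G$ (with common domains and exogenous arguments), such that the mechanism of each variable outside $\Delta^i\subseteq\mathbf V$ (its function and the distribution of its exogenous arguments) is the same in $\pi^i$ and $\pi^*$; this is the collective selection diagram $\mathcal G^{\boldsymbol\Delta}$. Let $\mathbb Z^i$ be the collection of sets $\mathbf Z$ on which experiments (yielding $P^i_{\mathbf z}$ for all $\mathbf z$) are available in $\pi^i$. Put $Q^i[\mathbf C](\mathbf v)=P^i_{\mathbf v\setminus\mathbf c}(\mathbf c)$. For a set $\mathbf X$ let $\mathbf Y^+=\mathrm{An}(Y)_{\mathcal G_{\underline{\mathbf X}}}$ and let $\mathbf C_1,\dots,\mathbf C_m$ be the maximal c-components (classes of vertices connected by bidirected paths) of $\mathcal G[\mathbf Y^+]$. For each $q$ choose a source $i_q$ with $\mathbf C_q\cap\Delta^{i_q}=\emptyset$ and a set $\mathbf C_q'\supseteq\mathbf C_q$ such that $Q^{i_q}[\mathbf C'_q]$ is computable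 from some $Q^{i_q}[\mathbf V\setminus\mathbf Z]$, $\mathbf Z\in\mathbb Z^{i_q}$; that is, $\mathbf C'_q$ arises from $\mathbf V\setminus\mathbf Z$ by repeatedly passing from a set $\mathbf A$ to an ancestral set or a maximal c-component of $\mathcal G[\mathbf A]$. Set $$L_q=U_q=\sum_{\mathbf c_q'\setminus\mathbf c_q}Q^{i_q}[\mathbf C_q']\quad\text{if }\mathrm{An}(\mathbf C_q)_{\mathcal G[\mathbf C_q']}=\mathbf C_q,$$ $$L_q=Q^{i_q}[\mathbf C_q'],\qquad U_q=Q^{i_q}[\mathbf C_q']+1-\sum_{\mathbf c_q}Q^{i_q}[\mathbf C_q']\quad\text{otherwise.}$$ The causal bounds are the following functions of $\mathbf v$ (variables outside $\mathbf Y^+$ take their values in $\mathbf v$), where the maximum and minimum run over all such choices and are $0$ and $\infty$ if there is none: $$\ell_{\mathbf X}(\mathbf v)=\max\Bigl\{0,\ \max\sum_{\mathbf y^+}y\prod_{q=1}^mL_q\Bigr\},\qquad u_{\mathbf X}(\mathbf v)=\min\sum_y y\,\min\Bigl\{1,\sum_{\mathbf y^+\setminus y}\prod_{q=1}^mU_q\Bigr\}.$$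 The bounds $\ell_{\mathbf x},u_{\mathbf x}$ of the single action $do(\mathbf X=\mathbf x)$ are the maximum of $\ell_{\mathbf X}(\mathbf v)$ and the minimum of $u_{\mathbf X}(\mathbf v)$ over all $\mathbf v$ that agree with $\mathbf x$ on $\mathrm{Pa}(\mathbf Y^+)_{\mathcal G}\setminus\mathbf Y^+$ (a subset of $\mathbf X$). **Statement.** Let $\mathbf R\subseteq\mathbf V\setminus\{Y\}$ be a POIS with respect to $\langle\mathcal G,Y\rangle$ and $\mathbf R^\dagger=\mathsf{IB}(\mathcal G_{\overline{\mathbf R}},Y)$. Then 1. $\mathbf R^\dagger$ is a POMIS with respect to $\langle\mathcal G,Y\rangle$, and $\mathbf R^\dagger\subseteq\mathbf R$; 2. $\mathbf R$ and $\mathbf R^\dagger$ are equivalent: $\mathbb E_{P_{\mathbf v[\mathbf R]}}Y=\mathbb E_{P_{\mathbf v[\mathbf R^\dagger]}}Y$ for every model conforming to $\mathcal G$ and every $\mathbf v$; 3. they share the causal bounds: for all environments and experiments as above, $\ell_{\mathbf R}=\ell_{\mathbf R^\dagger}$ and $u_{\mathbf R}=u_{\mathbf R^\dagger}$ as functions of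 $\mathbf v$, and $\ell_{\mathbf r}=\ell_{\mathbf r[\mathbf R^\dagger]}$ and $u_{\mathbf r}=u_{\mathbf r[\mathbf R^\dagger]}$ for every action $\mathbf r$ on $\mathbf R$. -/

import Mathlib

open MeasureTheory

noncomputable section

/-- A causal diagram (acyclic directed mixed graph) over the variables `V`: directed edges `dir`,
bidirected edges `bi` (unobserved confounding). -/
structure CausalDiagram (V : Type*) where
  dir : V → V → Prop
  bi : SimpleGraph V
  acyclic : ∀ i, ¬ Relation.TransGen dir i i

namespace CausalDiagram

variable {V : Type*}

/-- The subgraph `G[A]`. The vertex type is kept; vertices outside `A` become isolated. -/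
def induce (G : CausalDiagram V) (A : Set V) : CausalDiagram V where
  dir i j := G.dir i j ∧ i ∈ A ∧ j ∈ A
  bi :=
    { Adj := fun i j => G.bi.Adj i j ∧ i ∈ A ∧ j ∈ A
      symm := ⟨fun _ _ h => ⟨h.1.symm, h.2.2, h.2.1⟩⟩
      loopless := ⟨fun _ h => G.bi.irrefl h.1⟩ }
  acyclic i h := G.acyclic i (Relation.TransGen.mono (p := G.dir) (fun _ _ h => h.1) i i h)

/-- `G` with all edges into `X` removed (directed edges into `X` and bidirected edges at `X`). -/
def cutIn (G : CausalDiagram V) (X : Set V) : CausalDiagram V where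
  dir i j := G.dir i j ∧ j ∉ X
  bi :=
    { Adj := fun i j => G.bi.Adj i j ∧ i ∉ X ∧ j ∉ X
      symm := ⟨fun _ _ h => ⟨h.1.symm, h.2.2, h.2.1⟩⟩
      loopless := ⟨fun _ h => G.bi.irrefl h.1⟩ }
  acyclic i h := G.acyclic i (Relation.TransGen.mono (p := G.dir) (fun _ _ h => h.1) i i h)

/-- `G` with all directed edges out of `X` removed. -/
def cutOut (G : CausalDiagram V) (X : Set V) : CausalDiagram V where
  dir i j := G.dir i j ∧ i ∉ X
  bi := G.bi
  acyclic i h := G.acyclic i (Relation.TransGen.mono (p := G.dir) (fun _ _ h => h.1) i i h)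

/-- Ancestors of `S`, including `S`. -/
def An (G : CausalDiagram V) (S : Set V) : Set V :=
  {i | ∃ s ∈ S, Relation.ReflTransGen G.dir i s}

/-- Descendants of `S`, including `S`. -/
def De (G : CausalDiagram V) (S : Set V) : Set V :=
  {i | ∃ s ∈ S, Relation.ReflTransGen G.dir s i}

/-- Parents of members of `S`. -/
def Pa (G : CausalDiagram V) (S : Set V) : Set V := {i | ∃ s ∈ S, G.dir i s}

/-- Vertices joined to `S` by a path of bidirected edges, including `S`. -/
def CC (G : CausalDiagram V) (S : Set V) : Set V := {i | ∃ s ∈ S, G.bi.Reachable s i}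

/-- The maximal c-components of `G[A]`. -/
def components (G : CausalDiagram V) (A : Set V) : Set (Set V) :=
  {C | ∃ i ∈ A, C = (G.induce A).CC {i}}

/-- `T` is a UC-territory on `G` with respect to `Y`: with `H = G[An(Y)]`, `T` is a set of vertices
of `H` that contains `Y` and is closed under descendants and bidirected paths in `H`. -/
def IsUCTerritory (G : CausalDiagram V) (Y : V) (T : Set V) : Prop :=
  T ⊆ G.An {Y} ∧ Y ∈ T ∧ (G.induce (G.An {Y})).De T = T ∧ (G.induce (G.An {Y})).CC T = T

/-- The minimal UC-territory, see `muct_isLeast`. -/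
def muct (G : CausalDiagram V) (Y : V) : Set V := ⋂₀ {T | G.IsUCTerritory Y T}

/-- The interventional border. -/
def ib (G : CausalDiagram V) (Y : V) : Set V := G.Pa (G.muct Y) \ G.muct Y

theorem induce_reflTransGen_mem (G : CausalDiagram V) (A : Set V) {i j : V} (hi : i ∈ A)
    (h : Relation.ReflTransGen (G.induce A).dir i j) : j ∈ A := by
  induction h with
  | refl => exact hi
  | tail _ h _ => exact h.2.2

theorem induce_reachable_mem (G : CausalDiagram V) (A : Set V) {i j : V} (hi : i ∈ A)
    (h : (G.induce A).bi.Reachable i j) : j ∈ A := by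
  rw [SimpleGraph.reachable_iff_reflTransGen] at h
  induction h with
  | refl => exact hi
  | tail _ h _ => exact h.2.2

theorem isUCTerritory_an (G : CausalDiagram V) (Y : V) : G.IsUCTerritory Y (G.An {Y}) := by
  refine ⟨subset_rfl, ⟨Y, rfl, .refl⟩, ?_, ?_⟩
  · refine Set.Subset.antisymm ?_ fun i hi => ⟨i, hi, .refl⟩
    rintro i ⟨s, hs, h⟩
    exact G.induce_reflTransGen_mem _ hs h
  · refine Set.Subset.antisymm ?_ fun i hi => ⟨i, hi, .refl i⟩
    rintro i ⟨s, hs, h⟩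
    exact G.induce_reachable_mem _ hs h

/-- The minimal UC-territory is the least UC-territory. -/
theorem muct_isLeast (G : CausalDiagram V) (Y : V) :
    IsLeast {T | G.IsUCTerritory Y T} (G.muct Y) := by
  refine ⟨⟨?_, ?_, ?_, ?_⟩, fun T hT => Set.sInter_subset_of_mem hT⟩
  · exact Set.sInter_subset_of_mem (G.isUCTerritory_an Y)
  · exact fun T hT => hT.2.1
  · refine Set.Subset.antisymm ?_ fun i hi => ⟨i, hi, .refl⟩
    rintro i ⟨s, hs, h⟩ T hT
    rw [← hT.2.2.1]
    exact ⟨s, hs T hT, h⟩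
  · refine Set.Subset.antisymm ?_ fun i hi => ⟨i, hi, .refl i⟩
    rintro i ⟨s, hs, h⟩ T hT
    rw [← hT.2.2.2]
    exact ⟨s, hs T hT, h⟩

theorem wf [Finite V] (G : CausalDiagram V) : WellFounded G.dir := by
  have : Std.Irrefl (Relation.TransGen G.dir) := ⟨G.acyclic⟩
  exact Subrelation.wf (fun h => Relation.TransGen.single h)
    (Finite.wellFounded_of_trans_of_irrefl (Relation.TransGen G.dir))

end CausalDiagram

/-- What is shared by all models that are compared with each other: finite domains of the
endogenous variables, the numerical value of the reward variable `Y`, the exogenous variables with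
the spaces they take values in, and the exogenous arguments `scope i` of each structural function.
Two variables may share an exogenous variable only if `G` has a bidirected edge between them. -/
structure Frame {V : Type*} (G : CausalDiagram V) (Y : V) where
  dom : V → Type
  fintypeDom : ∀ i, Fintype (dom i)
  nonemptyDom : ∀ i, Nonempty (dom i)
  reward : dom Y → ℝ
  Exo : Type
  fintypeExo : Fintype Exo
  noise : Exo → Type
  measurableSpaceNoise : ∀ u, MeasurableSpace (noise u)
  scope : V → Set Exo
  confounded : ∀ i j, i ≠ j → (scope i ∩ scope j).Nonempty → G.bi.Adj i j

attribute [instance] Frame.fintypeDom Frame.nonemptyDom Frame.fintypeExo Frame.measurableSpaceNoise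

namespace Frame

variable {V : Type*} {G : CausalDiagram V} {Y : V}

/-- Joint values of all endogenous variables. -/
abbrev Assignment (F : Frame G Y) : Type _ := ∀ i, F.dom i

open Classical in
instance [Fintype V] (F : Frame G Y) : Fintype F.Assignment := Pi.instFintype

open Classical in
/-- `∑_a g(a, v ∖ a)`: sum over the values of the variables in `A`, the others being as in `v`. -/
def sumOver [Fintype V] (F : Frame G Y) (A : Set V) (v : F.Assignment) (g : F.Assignment → ℝ) : ℝ :=
  ∑ w : F.Assignment with ∀ i, i ∉ A → w i = v i, g w

end Frame

/-- A structural causal model that conforms to `G`: the function of a variable `i` takes the parents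
of `i` in `G` and the exogenous variables in `scope i`; exogenous variables are independent. -/
structure SCM {V : Type*} {G : CausalDiagram V} {Y : V} (F : Frame G Y) where
  f : ∀ i, (∀ j : {j // G.dir j i}, F.dom j) → (∀ u : F.scope i, F.noise u) → F.dom i
  measurable_f : ∀ i pa, @Measurable _ _ _ ⊤ (f i pa)
  law : ∀ u, Measure (F.noise u)
  isProbabilityMeasure_law : ∀ u, IsProbabilityMeasure (law u)

attribute [instance] SCM.isProbabilityMeasure_law

namespace SCM

variable {V : Type*} [Fintype V] {G : CausalDiagram V} {Y : V} {F : Frame G Y}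

open Classical in
/-- The values of the endogenous variables under `do(X = v[X])` for the unit `e`. -/
def solve (M : SCM F) (X : Set V) (v : F.Assignment) (e : ∀ u, F.noise u) : F.Assignment :=
  G.wf.fix fun i rec => if i ∈ X then v i else M.f i (fun j => rec j.1 j.2) (fun u => e u)

open Classical in
theorem solve_eq (M : SCM F) (X : Set V) (v : F.Assignment) (e : ∀ u, F.noise u) (i : V) :
    M.solve X v e i =
      if i ∈ X then v i else M.f i (fun j => M.solve X v e j) (fun u => e u) := by
  unfold solve
  rw [WellFounded.fix_eq]

/-- The distribution `P(U)`. -/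
def prior (M : SCM F) : Measure (∀ u, F.noise u) := Measure.pi M.law

/-- `E[Y]` under `do(X = v[X])`. -/
def expReward (M : SCM F) (X : Set V) (v : F.Assignment) : ℝ :=
  ∫ e, F.reward (M.solve X v e Y) ∂M.prior

/-- The maximal expected reward over all actions `do(X = x)`. -/
def best (M : SCM F) (X : Set V) : ℝ := ⨆ v : F.Assignment, M.expReward X v

/-- The c-factor `Q[C](v) = P_{v ∖ c}(c)`. -/
def Q (M : SCM F) (C : Set V) (v : F.Assignment) : ℝ :=
  M.prior.real {e | ∀ i ∈ C, M.solve Cᶜ v e i = v i}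

end SCM

namespace CausalDiagram

variable {V : Type*} [Fintype V]

/-- `X` and `W` are equivalent in terms of expected reward: in every model that conforms to `G`, the
actions that `v` prescribes on `X` and on `W` have the same expected reward. -/
def RewardEquiv (G : CausalDiagram V) (Y : V) (X W : Set V) : Prop :=
  ∀ (F : Frame G Y) (M : SCM F) (v : F.Assignment), M.expReward X v = M.expReward W v

/-- Minimal intervention set. -/
def IsMIS (G : CausalDiagram V) (Y : V) (X : Set V) : Prop :=
  Y ∉ X ∧ ∀ X' : Set V, X' ⊂ X → ¬ G.RewardEquiv Y X' X

/-- Possibly-optimal minimal intervention set. -/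
def IsPOMIS (G : CausalDiagram V) (Y : V) (X : Set V) : Prop :=
  G.IsMIS Y X ∧ ∃ (F : Frame G Y) (M : SCM F),
    ∀ W : Set V, G.IsMIS Y W → W ≠ X → M.best W < M.best X

/-- Possibly-optimal intervention set: some model makes `X` strictly better than every intervention
set that is not equivalent to it. -/
def IsPOIS (G : CausalDiagram V) (Y : V) (X : Set V) : Prop :=
  Y ∉ X ∧ ∃ (F : Frame G Y) (M : SCM F),
    ∀ W : Set V, Y ∉ W → ¬ G.RewardEquiv Y W X → M.best W < M.best X

/-- `Q[C]` is computable from `Q[D]` by repeatedly passing to ancestral sets and to c-components. -/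
inductive Computable (G : CausalDiagram V) (D : Set V) : Set V → Prop
  | self : Computable G D D
  | ancestral {A C : Set V} :
      Computable G D A → C ⊆ A → (G.induce A).An C = C → Computable G D C
  | component {A C : Set V} : Computable G D A → C ∈ G.components A → Computable G D C

/-- The variables `Y⁺` that matter for the reward under an intervention on `X`. -/
def yPlus (G : CausalDiagram V) (Y : V) (X : Set V) : Set V := (G.cutOut X).An {Y}

end CausalDiagram

/-- A target environment and `n` source environments that induce the collective selection diagram
given by `G` and the discrepancy sets `Δ 0, …, Δ (n - 1)`: the mechanism of a variable outside `Δ i`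
(its function and the distribution of its exogenous arguments) is the same in source `i` and in the
target. -/
structure Environments {V : Type*} {G : CausalDiagram V} {Y : V} (F : Frame G Y) {n : ℕ}
    (Δ : Fin n → Set V) where
  target : SCM F
  source : Fin n → SCM F
  agree : ∀ i, ∀ j ∉ Δ i,
    (source i).f j = target.f j ∧ ∀ u ∈ F.scope j, (source i).law u = target.law u

namespace SCM

variable {V : Type*} [Fintype V] {G : CausalDiagram V} {Y : V} {F : Frame G Y}

open Classical in
/-- Lower bound for the target c-factor of `C` through the source c-factor of `C' ⊇ C`. -/
def lowerFactor (M : SCM F) (C C' : Set V) (v : F.Assignment) : ℝ :=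
  if (G.induce C').An C = C then F.sumOver (C' \ C) v (M.Q C') else M.Q C' v

open Classical in
/-- Upper bound for the target c-factor of `C` through the source c-factor of `C' ⊇ C`. -/
def upperFactor (M : SCM F) (C C' : Set V) (v : F.Assignment) : ℝ :=
  if (G.induce C').An C = C then F.sumOver (C' \ C) v (M.Q C')
  else M.Q C' v + 1 - F.sumOver C v (M.Q C')

end SCM

namespace Environments

variable {V : Type*} [Fintype V] {G : CausalDiagram V} {Y : V} {F : Frame G Y} {n : ℕ}
  {Δ : Fin n → Set V}

/-- `σ` assigns to every c-component `C` of `G[Y⁺]` a source `i` and a set `C' ⊇ C`. It is admissible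
if `C` has no discrepancy in source `i` and the c-factor of `C'` in source `i` is computable from one
of the experiments `Z ∈ Zs i` conducted there, that is, from `Q[V ∖ Z] = P_z`. -/
def Admissible (_E : Environments F Δ) (Zs : Fin n → Set (Set V)) (X : Set V)
    (σ : Set V → Fin n × Set V) : Prop :=
  ∀ C ∈ G.components (G.yPlus Y X),
    C ⊆ (σ C).2 ∧ Disjoint C (Δ (σ C).1) ∧ ∃ Z ∈ Zs (σ C).1, G.Computable Zᶜ (σ C).2

open Classical in
/-- The expression `∑_{y⁺} y ∏_q (lower bound for Q*[C_q])`. Variables outside `Y⁺` have their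
values in `v`. -/
def lowerExpr (E : Environments F Δ) (X : Set V) (σ : Set V → Fin n × Set V)
    (v : F.Assignment) : ℝ :=
  F.sumOver (G.yPlus Y X) v fun w =>
    F.reward (w Y) * ∏ C : Set V with C ∈ G.components (G.yPlus Y X),
      (E.source (σ C).1).lowerFactor C (σ C).2 w

open Classical in
/-- The expression `∑_y y min{1, ∑_{y⁺ ∖ y} ∏_q (upper bound for Q*[C_q])}`. Variables outside `Y⁺`
have their values in `v`. -/
def upperExpr (E : Environments F Δ) (X : Set V) (σ : Set V → Fin n × Set V)
    (v : F.Assignment) : ℝ :=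
  ∑ y : F.dom Y, F.reward y *
    min 1 (∑ w : F.Assignment with (∀ i, i ∉ G.yPlus Y X → w i = v i) ∧ w Y = y,
      ∏ C : Set V with C ∈ G.components (G.yPlus Y X),
        (E.source (σ C).1).upperFactor C (σ C).2 w)

/-- The lower causal bound as an expression in `v`: the largest of `0` and all lower expressions. -/
def lowerBoundAt (E : Environments F Δ) (Zs : Fin n → Set (Set V)) (X : Set V)
    (v : F.Assignment) : EReal :=
  0 ⊔ ⨆ (σ : Set V → Fin n × Set V) (_ : E.Admissible Zs X σ), (E.lowerExpr X σ v : EReal)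

/-- The upper causal bound as an expression in `v`: the least of all upper expressions, and `∞` if
there is none. -/
def upperBoundAt (E : Environments F Δ) (Zs : Fin n → Set (Set V)) (X : Set V)
    (v : F.Assignment) : EReal :=
  ⨅ (σ : Set V → Fin n × Set V) (_ : E.Admissible Zs X σ), (E.upperExpr X σ v : EReal)

/-- The variables outside `Y⁺` on which the reward can depend under an intervention on `X`. They lie
in `X`, see `relevant_subset`. -/
def relevant (_E : Environments F Δ) (X : Set V) : Set V :=
  G.Pa (G.yPlus Y X) \ G.yPlus Y X

theorem relevant_subset (E : Environments F Δ) (X : Set V) : E.relevant X ⊆ X := by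
  rintro i ⟨⟨s, ⟨t, ht, hst⟩, hi⟩, hn⟩
  by_contra hX
  exact hn ⟨t, ht, .head ⟨hi, hX⟩ hst⟩

/-- The lower causal bound of the action `do(X = v[X])`, a function of `v[X]` alone: the expressions
are valid for all values of the variables outside `Y⁺` that cannot affect the reward, and the best
of these values is taken. -/
def lowerBound (E : Environments F Δ) (Zs : Fin n → Set (Set V)) (X : Set V)
    (v : F.Assignment) : EReal :=
  ⨆ (w : F.Assignment) (_ : ∀ i ∈ E.relevant X, w i = v i), E.lowerBoundAt Zs X w

/-- The upper causal bound of the action `do(X = v[X])`, see `lowerBound`. -/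
def upperBound (E : Environments F Δ) (Zs : Fin n → Set (Set V)) (X : Set V)
    (v : F.Assignment) : EReal :=
  ⨅ (w : F.Assignment) (_ : ∀ i ∈ E.relevant X, w i = v i), E.upperBoundAt Zs X w

end Environments

end

/-! Call `z ∈ X` essential if `z` reaches `Y` in `G` without the edges into `X`. Intervening on `X`
has the same effect as intervening on its essential members, and in the model where a variable is
true iff one of its parents is, these members can be recovered from the expected reward. So
equivalent sets have the same essential members, and minimal intervention sets consist of
essential members.

Let `T` be the minimal UC-territory of `G` without the edges into `R`. Its border `R†` is minimal,
because `T` reaches `Y` inside itself. The exogenous arguments of `T` are independent of those of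
the remaining ancestors of `Y`, so `do(R = r)` acts on `Y` as a mixture of the actions on `R†` whose
weights are the distribution of `R†` under `do(R = r)`. Hence the best action on `R†` is at least as
good as any on `R`, which for a POIS `R` is possible only if `R` and `R†` are equivalent. Finally,
the causal bounds depend on `R` only through `Y⁺`, which is determined by the essential members.
-/

theorem measurePreserving_piecewise_pi {ι : Type*} [Fintype ι] {α : ι → Type*}
    [∀ i, MeasurableSpace (α i)] (μ : ∀ i, Measure (α i)) [∀ i, IsProbabilityMeasure (μ i)]
    (S : Set ι) [∀ i, Decidable (i ∈ S)] :
    MeasurePreserving (fun p : (∀ i, α i) × (∀ i, α i) => S.piecewise p.2 p.1)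
      ((Measure.pi μ).prod (Measure.pi μ)) (Measure.pi μ) := by
  have measurable_piecewise :
      Measurable fun p : (∀ i, α i) × (∀ i, α i) => S.piecewise p.2 p.1 := by
    refine measurable_pi_lambda _ fun i => ?_
    by_cases hi : i ∈ S <;> simp only [Set.piecewise, hi, if_true, if_false] <;> fun_prop
  refine ⟨measurable_piecewise, (Measure.pi_eq fun s hs => ?_).symm⟩
  have preimage_box : (fun p : (∀ i, α i) × (∀ i, α i) => S.piecewise p.2 p.1) ⁻¹' Set.univ.pi s =
      (Set.univ.pi fun i => if i ∈ S then Set.univ else s i) ×ˢ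
        (Set.univ.pi fun i => if i ∈ S then s i else Set.univ) := by
    ext p
    simp only [Set.mem_preimage, Set.mem_univ_pi, Set.mem_prod, ← forall_and]
    refine forall_congr' fun i => ?_
    by_cases hi : i ∈ S <;> simp [hi]
  rw [Measure.map_apply measurable_piecewise (.univ_pi hs), preimage_box, Measure.prod_prod,
    Measure.pi_pi, Measure.pi_pi, ← Finset.prod_mul_distrib]
  refine Finset.prod_congr rfl fun i _ => ?_
  by_cases hi : i ∈ S <;> simp [hi]

namespace CausalDiagram

open Relation

variable {V : Type*} {G H : CausalDiagram V} {Y : V} {S T X W : Set V} {i j : V}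

theorem subset_an : S ⊆ G.An S := fun i hi => ⟨i, hi, .refl⟩

theorem mem_an_of_dir (hij : G.dir i j) (hj : j ∈ G.An S) : i ∈ G.An S := by
  obtain ⟨s, hs, hjs⟩ := hj
  exact ⟨s, hs, .head hij hjs⟩

theorem an_mono (h : ∀ i j, G.dir i j → H.dir i j) (S : Set V) : G.An S ⊆ H.An S :=
  fun _ ⟨s, hs, his⟩ => ⟨s, hs, ReflTransGen.mono h _ _ his⟩

theorem de_eq_self_iff : G.De S = S ↔ ∀ i ∈ S, ∀ j, G.dir i j → j ∈ S := by
  refine ⟨fun h i hi j hij => h ▸ ⟨i, hi, .single hij⟩, fun h => ?_⟩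
  refine Set.Subset.antisymm ?_ fun i hi => ⟨i, hi, .refl⟩
  rintro j ⟨i, hi, hij⟩
  induction hij with
  | refl => exact hi
  | tail _ hbc hb => exact h _ hb _ hbc

theorem cc_eq_self_iff : G.CC S = S ↔ ∀ i ∈ S, ∀ j, G.bi.Adj i j → j ∈ S := by
  refine ⟨fun h i hi j hij => h ▸ ⟨i, hi, hij.reachable⟩, fun h => ?_⟩
  refine Set.Subset.antisymm ?_ fun i hi => ⟨i, hi, .refl i⟩
  rintro j ⟨i, hi, hij⟩
  rw [SimpleGraph.reachable_iff_reflTransGen] at hij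
  induction hij with
  | refl => exact hi
  | tail _ hbc hb => exact h _ hb _ hbc

theorem isUCTerritory_iff : G.IsUCTerritory Y T ↔ T ⊆ G.An {Y} ∧ Y ∈ T ∧
    (∀ i ∈ T, ∀ j ∈ G.An {Y}, G.dir i j → j ∈ T) ∧
    ∀ i ∈ T, ∀ j ∈ G.An {Y}, G.bi.Adj i j → j ∈ T := by
  unfold IsUCTerritory
  rw [de_eq_self_iff, cc_eq_self_iff]
  refine and_congr_right fun hT => and_congr_right fun _ => and_congr ?_ ?_ <;>
    exact forall₂_congr fun i hi => forall_congr' fun j =>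
      ⟨fun h hj hij => h ⟨hij, hT hi, hj⟩, fun h hij => h hij.2.2 hij.1⟩

namespace IsUCTerritory

theorem mem_of_dir (hT : G.IsUCTerritory Y T) (hi : i ∈ T) (hj : j ∈ G.An {Y})
    (hij : G.dir i j) : j ∈ T :=
  (isUCTerritory_iff.1 hT).2.2.1 i hi j hj hij

theorem mem_of_adj (hT : G.IsUCTerritory Y T) (hi : i ∈ T) (hj : j ∈ G.An {Y})
    (hij : G.bi.Adj i j) : j ∈ T :=
  (isUCTerritory_iff.1 hT).2.2.2 i hi j hj hij

theorem sdiff_of_cutIn (hT : (G.cutIn X).IsUCTerritory Y T) (hY : Y ∉ X) :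
    (G.cutIn X).IsUCTerritory Y (T \ X) :=
  isUCTerritory_iff.2 ⟨Set.sdiff_subset.trans hT.1, ⟨hT.2.1, hY⟩,
    fun _ hi _ hj hij => ⟨hT.mem_of_dir hi.1 hj hij, hij.2⟩,
    fun _ hi _ hj hij => ⟨hT.mem_of_adj hi.1 hj hij, hij.2.2⟩⟩

end IsUCTerritory

theorem isUCTerritory_muct (G : CausalDiagram V) (Y : V) : G.IsUCTerritory Y (G.muct Y) :=
  (G.muct_isLeast Y).1

theorem disjoint_muct_cutIn (hY : Y ∉ X) : Disjoint ((G.cutIn X).muct Y) X :=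
  Set.disjoint_left.2 fun _ hi =>
    (((G.cutIn X).muct_isLeast Y).2 ((isUCTerritory_muct _ Y).sdiff_of_cutIn hY) hi).2

/-- The border of a set of vertices: its parents outside the set. The interventional border is the
border of the minimal UC-territory. -/
def border (G : CausalDiagram V) (T : Set V) : Set V := G.Pa T \ T

namespace IsUCTerritory

theorem border_subset_an (hT : G.IsUCTerritory Y T) : G.border T ⊆ G.An {Y} := by
  rintro i ⟨⟨t, ht, hit⟩, -⟩
  exact mem_an_of_dir hit (hT.1 ht)

theorem subset_an_cutIn_border (hT : G.IsUCTerritory Y T) :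
    T ⊆ (G.cutIn (G.border T)).An {Y} := by
  intro t ht
  obtain ⟨_, rfl, hty⟩ := hT.1 ht
  induction hty using ReflTransGen.head_induction_on with
  | refl => exact subset_an rfl
  | head hab hby ih =>
    have hb := hT.mem_of_dir ht ⟨_, rfl, hby⟩ hab
    exact mem_an_of_dir ⟨hab, fun hb' => hb'.2 hb⟩ (ih hb)

theorem border_subset_an_cutIn_border (hT : G.IsUCTerritory Y T) :
    G.border T ⊆ (G.cutIn (G.border T)).An {Y} := by
  rintro i ⟨⟨t, ht, hit⟩, -⟩
  exact mem_an_of_dir ⟨hit, fun ht' => ht'.2 ht⟩ (hT.subset_an_cutIn_border ht)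

end IsUCTerritory

/-- The essential members of an intervention set `X`: those which can affect `Y` through a directed
path that does not meet `X` again. -/
def essential (G : CausalDiagram V) (Y : V) (X : Set V) : Set V := X ∩ (G.cutIn X).An {Y}

theorem yPlus_anti (h : W ⊆ X) : G.yPlus Y X ⊆ G.yPlus Y W :=
  an_mono (G := G.cutOut X) (H := G.cutOut W)
    (fun _ _ hij => ⟨hij.1, fun hi => hij.2 (h hi)⟩) _

theorem yPlus_subset_an_cutIn_sdiff (hY : Y ∉ X) : G.yPlus Y X ⊆ (G.cutIn X).An {Y} \ X := by
  rintro i ⟨_, rfl, hiy⟩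
  induction hiy using ReflTransGen.head_induction_on with
  | refl => exact ⟨subset_an rfl, hY⟩
  | head hac _ ih => exact ⟨mem_an_of_dir ⟨hac.1, ih.2⟩ ih.1, hac.2⟩

theorem yPlus_essential (hY : Y ∉ X) : G.yPlus Y (G.essential Y X) = G.yPlus Y X := by
  refine Set.Subset.antisymm ?_ (yPlus_anti Set.inter_subset_left)
  rintro i ⟨_, rfl, hiy⟩
  induction hiy using ReflTransGen.head_induction_on with
  | refl => exact subset_an rfl
  | @head a c hac _ hc =>
    obtain ⟨hcY, hcX⟩ := yPlus_subset_an_cutIn_sdiff hY hc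
    have ha : a ∉ X := fun ha => hac.2 ⟨ha, mem_an_of_dir ⟨hac.1, hcX⟩ hcY⟩
    exact mem_an_of_dir ⟨hac.1, ha⟩ hc

end CausalDiagram

namespace Frame

variable {V : Type*} {G : CausalDiagram V} {Y : V}

/-- The domains are finite, so they carry the discrete σ-algebra. -/
instance (F : Frame G Y) (i : V) : MeasurableSpace (F.dom i) := ⊤

instance (F : Frame G Y) (i : V) : DiscreteMeasurableSpace (F.dom i) := ⟨fun _ => trivial⟩

/-- The exogenous variables that are arguments of the function of some variable in `T`. -/
def exoArgs (F : Frame G Y) (T : Set V) : Set F.Exo := ⋃ i ∈ T, F.scope i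

end Frame

namespace SCM

variable {V : Type*} {G : CausalDiagram V} {Y : V} {F : Frame G Y}

instance (M : SCM F) : IsProbabilityMeasure M.prior := by
  unfold prior; infer_instance

variable [Fintype V] {X W A : Set V} {v w : F.Assignment} {e e' : ∀ u, F.noise u} {i : V}

theorem solve_of_mem (M : SCM F) (v : F.Assignment) (e : ∀ u, F.noise u) (hi : i ∈ X) :
    M.solve X v e i = v i := by
  rw [solve_eq, if_pos hi]

theorem solve_of_notMem (M : SCM F) (v : F.Assignment) (e : ∀ u, F.noise u) (hi : i ∉ X) :
    M.solve X v e i = M.f i (fun j => M.solve X v e j) (fun u => e u) := by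
  rw [solve_eq, if_neg hi]

theorem solve_congr (M : SCM F)
    (h : ∀ i ∈ A, M.solve X v e i = M.solve W w e' i ∨
      (i ∉ X ∧ i ∉ W ∧ (∀ j, G.dir j i → j ∈ A) ∧ ∀ u ∈ F.scope i, e u = e' u)) :
    ∀ i ∈ A, M.solve X v e i = M.solve W w e' i := by
  intro i
  induction i using G.wf.induction with
  | _ i ih =>
    intro hi
    rcases h i hi with heq | ⟨hX, hW, hpa, hexo⟩
    · exact heq
    · rw [M.solve_of_notMem v e hX, M.solve_of_notMem w e' hW,
        funext fun j : {j // G.dir j i} => ih j j.2 (hpa j j.2),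
        funext fun u : F.scope i => hexo u u.2]

theorem measurable_solve (M : SCM F) (X : Set V) (v : F.Assignment) :
    Measurable (M.solve X v) := by
  refine measurable_pi_lambda _ fun i => ?_
  induction i using G.wf.induction with
  | _ i ih =>
    by_cases hi : i ∈ X
    · simp only [M.solve_of_mem v _ hi, measurable_const]
    · simp only [M.solve_of_notMem v _ hi]
      have measurable_f : Measurable fun p : (∀ j : {j // G.dir j i}, F.dom j) ×
          (∀ u : F.scope i, F.noise u) => M.f i p.1 p.2 :=
        measurable_from_prod_countable_right (M.measurable_f i)
      have measurable_parents :
          Measurable fun e => fun j : {j // G.dir j i} => M.solve X v e j :=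
        measurable_pi_lambda _ fun j => ih j j.2
      exact measurable_f.comp (measurable_parents.prodMk (by fun_prop))

theorem expReward_eq_of_forall (M : SCM F) {c : ℝ} (h : ∀ e, F.reward (M.solve X v e Y) = c) :
    M.expReward X v = c := by
  simp only [expReward, h, integral_const, probReal_univ, one_smul]

theorem integrable_comp_solve (M : SCM F) (X : Set V) (v : F.Assignment)
    (g : F.Assignment → ℝ) : Integrable (fun e => g (M.solve X v e)) M.prior :=
  Integrable.of_finite.comp_measurable (M.measurable_solve X v)

theorem expReward_le_best (M : SCM F) (X : Set V) (v : F.Assignment) :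
    M.expReward X v ≤ M.best X :=
  le_ciSup (Set.finite_range _).bddAbove v

/-- Resampling the exogenous variables in `S` leaves their joint law unchanged, but makes the values
of `W` independent of the noise that acts between `W` and `Y`. -/
theorem expReward_eq_integral_expReward (M : SCM F) {S : Set F.Exo} [∀ u, Decidable (u ∈ S)]
    (h : ∀ e e', M.solve X v (S.piecewise e' e) Y = M.solve W (M.solve X v e) e' Y) :
    M.expReward X v = ∫ e, M.expReward W (M.solve X v e) ∂M.prior := by
  have resample : MeasurePreserving
      (fun p : (∀ u, F.noise u) × (∀ u, F.noise u) => S.piecewise p.2 p.1)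
      (M.prior.prod M.prior) M.prior :=
    measurePreserving_piecewise_pi M.law S
  have integrable_reward := M.integrable_comp_solve X v fun w => F.reward (w Y)
  calc M.expReward X v
      = ∫ p, F.reward (M.solve X v (S.piecewise p.2 p.1) Y) ∂M.prior.prod M.prior := by
        rw [expReward, ← resample.map_eq, integral_map resample.aemeasurable
          (by rw [resample.map_eq]; exact integrable_reward.aestronglyMeasurable),
          resample.map_eq]
    _ = ∫ e, ∫ e', F.reward (M.solve X v (S.piecewise e' e) Y) ∂M.prior ∂M.prior :=
        integral_prod _ (resample.integrable_comp_of_integrable integrable_reward)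
    _ = ∫ e, M.expReward W (M.solve X v e) ∂M.prior := by simp only [h, expReward]

theorem integral_expReward_le_best (M : SCM F) (X W : Set V) (v : F.Assignment) :
    ∫ e, M.expReward W (M.solve X v e) ∂M.prior ≤ M.best W :=
  calc ∫ e, M.expReward W (M.solve X v e) ∂M.prior
      ≤ ∫ _, M.best W ∂M.prior :=
        integral_mono (M.integrable_comp_solve X v _) (integrable_const _)
          fun _ => M.expReward_le_best W _
    _ = M.best W := by simp

end SCM

namespace CausalDiagram

variable {V : Type*} {G : CausalDiagram V} {Y : V} {T X W R : Set V}

namespace IsUCTerritory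

variable {F : Frame G Y}

theorem disjoint_scope_exoArgs (hT : (G.cutIn X).IsUCTerritory Y T) (hTX : Disjoint T X)
    (F : Frame G Y) {i : V} (hi : i ∈ (G.cutIn X).An {Y} \ T) (hiX : i ∉ X) :
    Disjoint (F.scope i) (F.exoArgs T) := by
  refine Set.disjoint_left.2 fun u hui huT => ?_
  obtain ⟨t, ht, hut⟩ := Set.mem_iUnion₂.1 huT
  have hti : G.bi.Adj t i := F.confounded t i (fun h => hi.2 (h ▸ ht)) ⟨u, hut, hui⟩
  exact hi.2 (hT.mem_of_adj ht hi.1 ⟨hti, Set.disjoint_left.1 hTX ht, hiX⟩)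

variable [Fintype V]

open Classical in
theorem solve_piecewise_of_notMem (hT : (G.cutIn X).IsUCTerritory Y T) (hTX : Disjoint T X)
    (M : SCM F) (v : F.Assignment) (e e' : ∀ u, F.noise u) :
    ∀ i ∈ (G.cutIn X).An {Y} \ T,
      M.solve X v ((F.exoArgs T).piecewise e' e) i = M.solve X v e i := by
  refine M.solve_congr fun i hi => ?_
  by_cases hX : i ∈ X
  · exact .inl (by rw [M.solve_of_mem v _ hX, M.solve_of_mem v _ hX])
  · refine .inr ⟨hX, hX, fun j hji => ?_, fun u hu => ?_⟩
    · have hji' : (G.cutIn X).dir j i := ⟨hji, hX⟩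
      exact ⟨mem_an_of_dir hji' hi.1, fun hj => hi.2 (hT.mem_of_dir hj hi.1 hji')⟩
    · exact Set.piecewise_eq_of_notMem _ _ _
        (Set.disjoint_left.1 (hT.disjoint_scope_exoArgs hTX F hi hX) hu)

open Classical in
theorem solve_piecewise (hT : (G.cutIn X).IsUCTerritory Y T) (hTX : Disjoint T X)
    (M : SCM F) (v : F.Assignment) (e e' : ∀ u, F.noise u) :
    ∀ i ∈ T ∪ (G.cutIn X).border T, M.solve X v ((F.exoArgs T).piecewise e' e) i =
      M.solve ((G.cutIn X).border T) (M.solve X v e) e' i := by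
  refine M.solve_congr fun i hi => ?_
  rcases hi with hi | hi
  · have hiX := Set.disjoint_left.1 hTX hi
    refine .inr ⟨hiX, fun h => h.2 hi, fun j hji => ?_, fun u hu => ?_⟩
    · exact or_iff_not_imp_left.2 fun hj => ⟨⟨i, hi, hji, hiX⟩, hj⟩
    · exact Set.piecewise_eq_of_mem _ _ _ (Set.mem_biUnion hi hu)
  · refine .inl ?_
    rw [M.solve_of_mem _ _ hi]
    exact hT.solve_piecewise_of_notMem hTX M v e e' i ⟨hT.border_subset_an hi, hi.2⟩

theorem best_le_best_border (hT : (G.cutIn X).IsUCTerritory Y T) (hTX : Disjoint T X)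
    (M : SCM F) : M.best X ≤ M.best ((G.cutIn X).border T) := by
  classical
  refine ciSup_le fun v => ?_
  rw [M.expReward_eq_integral_expReward
    fun e e' => hT.solve_piecewise hTX M v e e' Y (.inl hT.2.1)]
  exact M.integral_expReward_le_best X _ v

end IsUCTerritory

/-- The frame with Boolean variables and no exogenous variables whose reward is one if `Y` is true
and zero otherwise. -/
abbrev boolFrame (G : CausalDiagram V) (Y : V) : Frame G Y where
  dom _ := Bool
  fintypeDom _ := inferInstance
  nonemptyDom _ := inferInstance
  reward b := if b then 1 else 0
  Exo := Empty
  fintypeExo := inferInstance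
  noise _ := Unit
  measurableSpaceNoise _ := inferInstance
  scope _ := ∅
  confounded := by simp

open Classical in
/-- The deterministic Boolean model in which a variable is true iff one of its parents is. It
distinguishes intervention sets with different essential members. -/
noncomputable def orModel (G : CausalDiagram V) (Y : V) : SCM (G.boolFrame Y) where
  f _ pa _ := decide (∃ j, pa j = true)
  measurable_f _ _ := @measurable_const _ _ ⊤ _ _
  law u := u.elim
  isProbabilityMeasure_law u := u.elim

variable [Fintype V]

open Relation in
theorem orModel_solve_iff (v : (G.boolFrame Y).Assignment) (e : ∀ u, (G.boolFrame Y).noise u)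
    (i : V) : (G.orModel Y).solve X v e i = true ↔
      ∃ z ∈ X, v z = true ∧ ReflTransGen (G.cutIn X).dir z i := by
  induction i using G.wf.induction with
  | _ i ih =>
    by_cases hi : i ∈ X
    · rw [SCM.solve_of_mem _ _ _ hi]
      refine ⟨fun hv => ⟨i, hi, hv, .refl⟩, ?_⟩
      rintro ⟨z, -, hv, hzi⟩
      rcases hzi.cases_tail with rfl | ⟨b, -, hbi⟩
      · exact hv
      · exact absurd hi hbi.2
    · rw [SCM.solve_of_notMem _ _ _ hi]
      refine (@decide_eq_true_iff _ (_)).trans ⟨?_, ?_⟩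
      · rintro ⟨⟨j, hji⟩, hj⟩
        obtain ⟨z, hz, hv, hzj⟩ := (ih j hji).1 hj
        exact ⟨z, hz, hv, hzj.tail ⟨hji, hi⟩⟩
      · rintro ⟨z, hz, hv, hzi⟩
        rcases hzi.cases_tail with rfl | ⟨j, hzj, hji⟩
        · exact absurd hz hi
        · exact ⟨⟨j, hji.1⟩, (ih j hji.1).2 ⟨z, hz, hv, hzj⟩⟩

open Classical in
theorem orModel_expReward (v : (G.boolFrame Y).Assignment) :
    (G.orModel Y).expReward X v = if ∃ z ∈ G.essential Y X, v z = true then 1 else 0 := by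
  have solve_iff (e) : (G.orModel Y).solve X v e Y = true ↔
      ∃ z ∈ G.essential Y X, v z = true := by
    rw [orModel_solve_iff]
    simp only [essential, An, Set.mem_inter_iff, Set.mem_ofPred_eq, Set.mem_singleton_iff,
      exists_eq_left, and_left_comm, and_comm]
  exact SCM.expReward_eq_of_forall _ fun e => if_congr (solve_iff e) rfl rfl

theorem rewardEquiv_essential (G : CausalDiagram V) (Y : V) (X : Set V) :
    G.RewardEquiv Y (G.essential Y X) X := by
  intro F M v
  have solve_eq (e) : M.solve (G.essential Y X) v e Y = M.solve X v e Y := by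
    refine M.solve_congr (A := (G.cutIn X).An {Y}) (fun i hi => ?_) Y (subset_an rfl)
    by_cases hX : i ∈ X
    · exact .inl (by rw [M.solve_of_mem v e (show i ∈ G.essential Y X from ⟨hX, hi⟩),
        M.solve_of_mem v e hX])
    · exact .inr ⟨fun h => hX h.1, hX, fun j hj => mem_an_of_dir ⟨hj, hX⟩ hi, fun _ _ => rfl⟩
  simp only [SCM.expReward, solve_eq]

namespace RewardEquiv

theorem symm (h : G.RewardEquiv Y X W) : G.RewardEquiv Y W X := fun F M v => (h F M v).symm

theorem trans (h : G.RewardEquiv Y X W) (h' : G.RewardEquiv Y W R) : G.RewardEquiv Y X R :=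
  fun F M v => (h F M v).trans (h' F M v)

theorem best_eq (h : G.RewardEquiv Y X W) {F : Frame G Y} (M : SCM F) : M.best X = M.best W :=
  iSup_congr fun v => h F M v

theorem essential_eq (h : G.RewardEquiv Y X W) : G.essential Y X = G.essential Y W := by
  classical
  ext z
  have hz := h _ (G.orModel Y) fun j => decide (j = z)
  simp only [orModel_expReward, decide_eq_true_iff, exists_eq_right] at hz
  split_ifs at hz <;> simp_all

theorem yPlus_eq (h : G.RewardEquiv Y X W) (hX : Y ∉ X) (hW : Y ∉ W) :
    G.yPlus Y X = G.yPlus Y W := by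
  rw [← yPlus_essential hX, h.essential_eq, yPlus_essential hW]

end RewardEquiv

theorem isMIS_iff : G.IsMIS Y X ↔ Y ∉ X ∧ G.essential Y X = X := by
  refine and_congr_right fun _ => ⟨fun h => ?_, fun h X' hX' hequiv => ?_⟩
  · by_contra hne
    exact h _ (Set.inter_subset_left.ssubset_of_ne hne) (G.rewardEquiv_essential Y X)
  · have hsub : X ⊆ X' := by
      rw [← h, ← hequiv.essential_eq]
      exact Set.inter_subset_left
    exact hX'.2 hsub

theorem IsMIS.eq_of_rewardEquiv (hX : G.IsMIS Y X) (hW : G.IsMIS Y W)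
    (h : G.RewardEquiv Y X W) : X = W := by
  rw [← (isMIS_iff.1 hX).2, h.essential_eq, (isMIS_iff.1 hW).2]

theorem IsMIS.subset_of_rewardEquiv (hX : G.IsMIS Y X) (h : G.RewardEquiv Y X W) : X ⊆ W := by
  rw [← (isMIS_iff.1 hX).2, h.essential_eq]
  exact Set.inter_subset_left

theorem IsUCTerritory.isMIS_border (hT : (G.cutIn X).IsUCTerritory Y T) :
    G.IsMIS Y ((G.cutIn X).border T) := by
  set B := (G.cutIn X).border T
  have hB : B ⊆ (G.cutIn B).An {Y} :=
    hT.border_subset_an_cutIn_border.trans <|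
      an_mono (G := (G.cutIn X).cutIn B) (H := G.cutIn B) (fun _ _ h => ⟨h.1.1, h.2⟩) _
  exact isMIS_iff.2 ⟨fun h => h.2 hT.2.1, Set.inter_eq_left.2 hB⟩

theorem isMIS_ib_cutIn (G : CausalDiagram V) (Y : V) (X : Set V) : G.IsMIS Y ((G.cutIn X).ib Y) :=
  (isUCTerritory_muct _ Y).isMIS_border

theorem best_le_best_ib_cutIn (hY : Y ∉ X) {F : Frame G Y} (M : SCM F) :
    M.best X ≤ M.best ((G.cutIn X).ib Y) :=
  (isUCTerritory_muct _ Y).best_le_best_border (disjoint_muct_cutIn hY) M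

theorem IsPOIS.rewardEquiv_ib_cutIn (hR : G.IsPOIS Y R) :
    G.RewardEquiv Y R ((G.cutIn R).ib Y) := by
  obtain ⟨hY, F, M, hbest⟩ := hR
  by_contra hne
  exact (best_le_best_ib_cutIn hY M).not_gt
    (hbest _ (G.isMIS_ib_cutIn Y R).1 fun h => hne h.symm)

theorem IsPOIS.isPOMIS_of_rewardEquiv (hR : G.IsPOIS Y R) (hX : G.IsMIS Y X)
    (h : G.RewardEquiv Y R X) : G.IsPOMIS Y X := by
  obtain ⟨-, F, M, hbest⟩ := hR
  refine ⟨hX, F, M, fun W hW hne => ?_⟩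
  rw [← h.best_eq M]
  exact hbest W hW.1 fun hWR => hne (hW.eq_of_rewardEquiv hX (hWR.trans h))

end CausalDiagram

namespace Environments

variable {V : Type*} [Fintype V] {G : CausalDiagram V} {Y : V} {F : Frame G Y} {n : ℕ}
  {Δ : Fin n → Set V} {X W : Set V}

theorem lowerBoundAt_congr (E : Environments F Δ) (Zs : Fin n → Set (Set V))
    (h : G.yPlus Y X = G.yPlus Y W) (v : F.Assignment) :
    E.lowerBoundAt Zs X v = E.lowerBoundAt Zs W v := by
  unfold lowerBoundAt Admissible lowerExpr
  rw [h]

theorem upperBoundAt_congr (E : Environments F Δ) (Zs : Fin n → Set (Set V))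
    (h : G.yPlus Y X = G.yPlus Y W) (v : F.Assignment) :
    E.upperBoundAt Zs X v = E.upperBoundAt Zs W v := by
  unfold upperBoundAt Admissible upperExpr
  rw [h]

theorem lowerBound_congr (E : Environments F Δ) (Zs : Fin n → Set (Set V))
    (h : G.yPlus Y X = G.yPlus Y W) (v : F.Assignment) :
    E.lowerBound Zs X v = E.lowerBound Zs W v := by
  simp only [lowerBound, relevant, E.lowerBoundAt_congr Zs h, h]

theorem upperBound_congr (E : Environments F Δ) (Zs : Fin n → Set (Set V))
    (h : G.yPlus Y X = G.yPlus Y W) (v : F.Assignment) :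
    E.upperBound Zs X v = E.upperBound Zs W v := by
  simp only [upperBound, relevant, E.upperBoundAt_congr Zs h, h]

end Environments

theorem mainTheorem6 {V : Type*} [Fintype V] (G : CausalDiagram V) (Y : V) (R : Set V)
    (hR : G.IsPOIS Y R) :
    G.IsPOMIS Y ((G.cutIn R).ib Y) ∧
    (G.cutIn R).ib Y ⊆ R ∧
    (∀ (F : Frame G Y) (M : SCM F) (v : F.Assignment),
      M.expReward R v = M.expReward ((G.cutIn R).ib Y) v) ∧
    (∀ (F : Frame G Y) (n : ℕ) (Δ : Fin n → Set V) (E : Environments F Δ)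
      (Zs : Fin n → Set (Set V)) (v : F.Assignment),
      E.lowerBoundAt Zs R v = E.lowerBoundAt Zs ((G.cutIn R).ib Y) v ∧
      E.upperBoundAt Zs R v = E.upperBoundAt Zs ((G.cutIn R).ib Y) v ∧
      E.lowerBound Zs R v = E.lowerBound Zs ((G.cutIn R).ib Y) v ∧
      E.upperBound Zs R v = E.upperBound Zs ((G.cutIn R).ib Y) v) := by
  have hequiv := hR.rewardEquiv_ib_cutIn
  have hmis := G.isMIS_ib_cutIn Y R
  have hyPlus := hequiv.yPlus_eq hR.1 hmis.1
  exact ⟨hR.isPOMIS_of_rewardEquiv hmis hequiv, hmis.subset_of_rewardEquiv hequiv.symm, hequiv,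
    fun F n Δ E Zs v => ⟨E.lowerBoundAt_congr Zs hyPlus v, E.upperBoundAt_congr Zs hyPlus v,
      E.lowerBound_congr Zs hyPlus v, E.upperBound_congr Zs hyPlus v⟩⟩
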